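/- Let $G$ be a finite simple connected graph with $n$ vertices and $m$ edges, and let $D(G)=\{(u,v),(v,u)\mid uv\in E(G)\}$ be its set of arcs. Let $\Gamma$ be a finite group and $\alpha:D(G)\to\Gamma$ an ordinary voltage assignment, i.e. $\alpha(v,u)=\alpha(u,v)^{-1}$ for all $(u,v)\in D(G)$. The $\Gamma$-covering $G^\alpha$ is the graph with vertex set $V(G)\times\Gamma$ in which $((u,h),(v,k))$ is an arc if and only if $(u,v)\in D(G)$ and $k=h\,\alpha(u,v)$. Suppose that $G^\alpha$ is connected. For a connected graph $H$ with vertices $x_1,\dots,x_N$, of degrees $d_1,\dots,d_N$, and Laplacian $\mathbf L$ (the degree matrix minus the adjacency matrix), let $\kappa(H)$ be the number of spanning trees of $H$, let $r_{ij}=\det(\mathbf L^{(ij)})/\kappa(H)$ for $i\ne j$, where $\mathbf L^{(ij)}$ is obtained from $\mathbf L$ by deleting the $i$-th and $j$-th rows and columns, and put $$Kf^z(H)=\sum_{1\le i<j\le N}(d_i-2)(d_j-2)\,r_{ij}.$$ Let $\rho_1=1,\rho_2,\dots,\rho_k$ be all the irreducible complex matrix representations of $\Gamma$ up to equivalence,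 each listed once, and let $f_i$ be the degree of $\rho_i$ (so $f_1=1$). For $g\in\Gamma$ let $\mathbf A_g$ be the $n\times n$ matrix whose $(u,v)$ entry is $1$ if $(u,v)\in D(G)$ and $\alpha(u,v)=g$, and $0$ otherwise. Let $\mathbf Q=\mathbf D-\mathbf I_n$, where $\mathbf D$ is the diagonal matrix of the vertex degrees of $G$, and let $f_i\circ\mathbf Q=\mathbf I_{f_i}\otimes\mathbf Q$ be the block diagonal sum of $f_i$ copies of $\mathbf Q$. For $2\le i\le k$ set $$K_i(t)=\det\Bigl(\mathbf I_{f_in}-t\sum_{g\in\Gamma}\rho_i(g)\otimes\mathbf A_g+t^2(f_i\circ\mathbf Q)\Bigr).$$ Then, for $2\le i\le k$, $K_i(1)\neq0$ and the principal branch $\log K_i(t)$ is differentiable at $t=1$, and $$Kf^z(G^\alpha)=|\Gamma|\,Kf^z(G)-2(m-n)n\bigl(|\Gamma|^2-|\Gamma|\bigr)+2|\Gamma|(m-n)\sum_{i=2}^{k}f_i\,\frac{d}{dt}\log K_i(t)\Big|_{t=1}.$$ -/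

import Mathlib

open scoped Kronecker

/-- The number `κ(G)` of spanning trees of a graph. -/
noncomputable def SimpleGraph.complexity {V : Type*} (G : SimpleGraph V) : ℕ :=
  {T : SimpleGraph V | T ≤ G ∧ T.IsTree}.ncard

open Classical in
/-- The resistance distance `det L^{(ij)} / κ(G)`, where `L^{(ij)}` is the Laplacian with the
rows and columns of `i` and `j` deleted; it is `0` for `i = j`. -/
noncomputable def SimpleGraph.resistance {V : Type*} [Fintype V] (G : SimpleGraph V)
    (i j : V) : ℝ :=
  if i = j then 0
  else ((G.lapMatrix ℝ).submatrix
      (fun k : {k : V // k ≠ i ∧ k ≠ j} => (k : V))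
      (fun k : {k : V // k ≠ i ∧ k ≠ j} => (k : V))).det / (G.complexity : ℝ)

open Classical in
/-- The index `Kf^z(G)`: the sum of `(d_i - 2) (d_j - 2) r_{ij}` over unordered pairs of distinct
vertices, written as half of the sum over ordered pairs (the summand is symmetric and vanishes on
the diagonal; see `SimpleGraph.kirchhoffZ_eq_sum_lt`). -/
noncomputable def SimpleGraph.kirchhoffZ {V : Type*} [Fintype V] (G : SimpleGraph V) : ℝ :=
  (1 / 2) * ∑ i : V, ∑ j : V,
    ((G.degree i : ℝ) - 2) * ((G.degree j : ℝ) - 2) * G.resistance i j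

theorem SimpleGraph.resistance_comm {V : Type*} [Fintype V] (G : SimpleGraph V) (i j : V) :
    G.resistance i j = G.resistance j i := by
  classical
  unfold SimpleGraph.resistance
  by_cases h : i = j
  · subst h; rfl
  · rw [if_neg h, if_neg (Ne.symm h)]
    congr 1
    rw [← Matrix.det_submatrix_equiv_self
      (Equiv.subtypeEquivRight (fun k : V => and_comm (a := k ≠ i) (b := k ≠ j)))]
    rfl

open Classical in
theorem SimpleGraph.kirchhoffZ_eq_sum_lt {V : Type*} [Fintype V] [LinearOrder V]
    (G : SimpleGraph V) :
    G.kirchhoffZ = ∑ p : V × V with p.1 < p.2,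
      ((G.degree p.1 : ℝ) - 2) * ((G.degree p.2 : ℝ) - 2) * G.resistance p.1 p.2 := by
  unfold SimpleGraph.kirchhoffZ
  rw [← Finset.sum_product', Finset.univ_product_univ]
  set F : V × V → ℝ := fun p =>
    ((G.degree p.1 : ℝ) - 2) * ((G.degree p.2 : ℝ) - 2) * G.resistance p.1 p.2 with hF
  have hswap : ∀ p, F p.swap = F p := by
    intro p
    simp only [hF, Prod.fst_swap, Prod.snd_swap, G.resistance_comm p.2 p.1]
    ring
  have hdiag : ∀ p : V × V, p.1 = p.2 → F p = 0 := by
    intro p hp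
    simp [hF, hp, SimpleGraph.resistance]
  have h1 : ∑ p : V × V, F p
      = ∑ p : V × V with p.1 < p.2, F p + ∑ p : V × V with p.2 < p.1, F p := by
    rw [Finset.sum_filter, Finset.sum_filter, ← Finset.sum_add_distrib]
    refine Finset.sum_congr rfl fun p _ => ?_
    rcases lt_trichotomy p.1 p.2 with h | h | h
    · simp [h, h.not_gt]
    · simp [h, hdiag p h]
    · simp [h, h.not_gt]
  have h2 : ∑ p : V × V with p.2 < p.1, F p = ∑ p : V × V with p.1 < p.2, F p := by
    rw [Finset.sum_filter, Finset.sum_filter]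
    refine Fintype.sum_equiv (Equiv.prodComm V V) _ _ fun p => ?_
    simp [hswap p]
  change 1 / 2 * ∑ p : V × V, F p = _
  rw [h1, h2]
  ring

/-- An ordinary voltage assignment: a `Γ`-valued function on the arcs of `G` that takes inverse
values on inverse arcs. -/
structure VoltageAssignment {V : Type*} (G : SimpleGraph V) (Γ : Type*) [Group Γ] where
  val : G.Dart → Γ
  val_symm : ∀ e : G.Dart, val e.symm = (val e)⁻¹

namespace VoltageAssignment

variable {V : Type*} {G : SimpleGraph V} {Γ : Type*} [Group Γ]

/-- The derived graph (`Γ`-covering) `G^α` on `V × Γ`. -/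
def derivedGraph (α : VoltageAssignment G Γ) : SimpleGraph (V × Γ) where
  Adj p q := ∃ h : G.Adj p.1 q.1, q.2 = p.2 * α.val ⟨(p.1, q.1), h⟩
  symm := ⟨by
    rintro ⟨u, x⟩ ⟨v, y⟩ ⟨h, hy⟩
    refine ⟨h.symm, ?_⟩
    have hs := α.val_symm ⟨(u, v), h⟩
    change α.val ⟨(v, u), h.symm⟩ = _ at hs
    simp only at hy ⊢
    rw [hs, hy, mul_inv_cancel_right]⟩
  loopless := ⟨by
    rintro ⟨u, x⟩ ⟨h, -⟩
    exact G.loopless.irrefl u h⟩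

open Classical in
/-- The matrix `A_g`: the part of the adjacency matrix supported on the arcs of voltage `g`. -/
noncomputable def adjPart (α : VoltageAssignment G Γ) (g : Γ) : Matrix V V ℂ :=
  Matrix.of fun u v => if ∃ h : G.Adj u v, α.val ⟨(u, v), h⟩ = g then 1 else 0

open Classical in
/-- `det (I - t ∑_g ρ(g) ⊗ A_g + t² (d ∘ Q))`, where `Q = D - I` and `d ∘ Q = I_d ⊗ Q` is the
block diagonal sum of `d` copies of `Q`. -/
noncomputable def twistedDet [Fintype V] [Fintype Γ] (α : VoltageAssignment G Γ) {d : ℕ}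
    (ρ : Γ →* Matrix (Fin d) (Fin d) ℂ) (t : ℂ) : ℂ :=
  (1 - t • ∑ g : Γ, ρ g ⊗ₖ α.adjPart g
    + t ^ 2 • ((1 : Matrix (Fin d) (Fin d) ℂ) ⊗ₖ (G.degMatrix ℂ - 1))).det

end VoltageAssignment

/-- The linear representation on `ℂ^d` given by a matrix representation of degree `d`. -/
noncomputable def matrixRep {Γ : Type*} [Group Γ] {d : ℕ}
    (ρ : Γ →* Matrix (Fin d) (Fin d) ℂ) : Representation ℂ Γ (Fin d → ℂ) :=
  ((Matrix.toLinAlgEquiv' : Matrix (Fin d) (Fin d) ℂ ≃ₐ[ℂ] _) :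
    Matrix (Fin d) (Fin d) ℂ →* ((Fin d → ℂ) →ₗ[ℂ] (Fin d → ℂ))).comp ρ

/-- The family `ρ` of matrix representations, of degrees `f`, is a complete list, without
repetition up to equivalence, of the irreducible complex representations of `Γ`. -/
structure IsCompleteIrreducibleList {Γ ι : Type*} [Group Γ] (f : ι → ℕ)
    (ρ : (i : ι) → Γ →* Matrix (Fin (f i)) (Fin (f i)) ℂ) : Prop where
  irreducible : ∀ i, (matrixRep (ρ i)).IsIrreducible
  inequivalent : ∀ i j, Nonempty ((matrixRep (ρ i)).Equiv (matrixRep (ρ j))) → i = j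
  complete : ∀ (d : ℕ) (σ : Γ →* Matrix (Fin d) (Fin d) ℂ), (matrixRep σ).IsIrreducible →
    ∃ i, Nonempty ((matrixRep σ).Equiv (matrixRep (ρ i)))

/-! For a graph `H` on `N` vertices, put t = 1 + s in det(I - tA + t²(D - I)). The matrix becomes (1
+ s)L + s·diag((1 + s)(d_i - 2) + s), and its determinant expands along principal minors of L. The
constant term is det L = 0. By the matrix-tree theorem, the coefficient of s is κ Σ(d_i - 2). The
minors with two indices deleted are κ r_ij, so the coefficient of s² is κ(N Σ(d_i - 2) + N +
Kf^z(H)) (`coeff_two_iharaPolynomial`).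

The Fourier transform over Γ block-diagonalizes the adjacency matrix of the covering, and matrices
diag(c) lifted from the base are compatible with it
(`det_smul_adjMatrix_derivedGraph_add_diagonal`). Hence the polynomial of the covering is that of
`G` times ∏ K_i(1 + s)^{f_i} over the nontrivial i. The formula is the comparison of the s²
coefficients: the first-order term of the product supplies Σ f_i (log K_i)'(1).

The ratio of the two tree numbers comes from the same factorization applied to det(L + sI), whose
linear coefficient is Nκ. This gives |Γ| κ(G^α) = κ(G) ∏ K_i(1)^{f_i}, even when m = n, where the
Ihara linear coefficient vanishes. Connectedness of the covering then forces K_i(1) ≠ 0. Since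
K_i(1) is also a product of Laplacian eigenvalues of the covering, it is positive, hence off the
branch cut of the logarithm. -/

namespace SimpleGraph

/-! ### Rooted parent functions and the matrix-tree theorem -/

variable {V : Type*} {r : V}

open Classical in
/-- The self-map of `V` that fixes the root `r` and sends every other vertex to its parent. -/
noncomputable def parentStep (φ : {v : V // v ≠ r} → V) (v : V) : V :=
  if h : v = r then r else φ ⟨v, h⟩

/-- A parent function is rooted if every vertex reaches the root by iterating it. -/
def IsRooted (φ : {v : V // v ≠ r} → V) : Prop :=
  ∀ v, ∃ k, (parentStep φ)^[k] v = r

lemma parentStep_of_ne (φ : {v : V // v ≠ r} → V) (v : {v : V // v ≠ r}) :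
    parentStep φ v = φ v := by
  simp [parentStep, v.2]

lemma parentStep_root (φ : {v : V // v ≠ r} → V) : parentStep φ r = r := by
  simp [parentStep]

/-- A property that is inherited by parents holds at the root as soon as it holds anywhere. -/
lemma IsRooted.root_of_closed {φ : {v : V // v ≠ r} → V} (h : IsRooted φ) {P : V → Prop}
    (hP : ∀ v : {v : V // v ≠ r}, P v → P (φ v)) {v : V} (hv : P v) : P r := by
  obtain ⟨k, hk⟩ := h v
  have key : ∀ k v, P v → P ((parentStep φ)^[k] v) := by
    intro k
    induction k with
    | zero => simp
    | succ k ih =>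
      intro v hv
      rw [Function.iterate_succ_apply]
      apply ih
      by_cases hr : v = r
      · subst hr; rwa [parentStep_root]
      · have := hP ⟨v, hr⟩ hv
        rwa [← parentStep_of_ne φ ⟨v, hr⟩] at this
  exact hk ▸ key k v hv

/-- A property that passes from parents to children and holds at the root holds everywhere. -/
lemma IsRooted.induction {φ : {v : V // v ≠ r} → V} (h : IsRooted φ) {P : V → Prop}
    (hr : P r) (hP : ∀ v : {v : V // v ≠ r}, P (φ v) → P v) (v : V) : P v := by
  by_contra hv
  exact h.root_of_closed (P := fun v => ¬ P v) (fun v h1 h2 => h1 (hP v h2)) hv hr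

open Classical in
/-- The number of steps from a vertex to the root. -/
noncomputable def IsRooted.height {φ : {v : V // v ≠ r} → V} (h : IsRooted φ) (v : V) : ℕ :=
  Nat.find (h v)

lemma IsRooted.height_parent_lt {φ : {v : V // v ≠ r} → V} (h : IsRooted φ)
    (v : {v : V // v ≠ r}) : h.height (φ v) < h.height v := by
  classical
  have h1 := Nat.find_spec (h v)
  have h2 : h.height v ≠ 0 := by
    intro h0
    unfold height at h0
    rw [h0] at h1
    exact v.2 h1
  obtain ⟨k, hk⟩ := Nat.exists_eq_succ_of_ne_zero h2
  have h3 : (parentStep φ)^[k] (φ v) = r := by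
    unfold height at hk
    rw [hk, Function.iterate_succ_apply, parentStep_of_ne] at h1
    exact h1
  rw [hk]
  exact Nat.lt_succ_of_le (Nat.find_min' _ h3)

-- A rooted parent function makes the matrix unitriangular once vertices are ordered by height.
-- Otherwise the indicator of the vertices that never reach the root is a nonzero kernel vector.
open Classical in
lemma det_one_sub_parent [Fintype V] {R : Type*} [CommRing R] [IsDomain R]
    (φ : {v : V // v ≠ r} → V) :
    (Matrix.of fun v w : {v : V // v ≠ r} =>
      ((if (v : V) = w then 1 else 0) - (if φ v = w then 1 else 0) : R)).det
      = if IsRooted φ then 1 else 0 := by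
  split_ifs with h
  · have ht : (Matrix.of fun v w : {v : V // v ≠ r} =>
      ((if (v : V) = w then 1 else 0) - (if φ v = w then 1 else 0) : R)).BlockTriangular
        (fun v => OrderDual.toDual (h.height v)) := by
      intro v w hvw
      rw [OrderDual.toDual_lt_toDual] at hvw
      have h1 : (v : V) ≠ w := by rintro h1; rw [h1] at hvw; exact lt_irrefl _ hvw
      have h2 : φ v ≠ w := by
        intro h2
        have := h.height_parent_lt v
        rw [h2] at this
        exact lt_asymm this hvw
      simp [h1, h2]
    rw [ht.det]
    refine Finset.prod_eq_one fun a _ => ?_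
    refine Eq.trans (congrArg Matrix.det ?_) Matrix.det_one
    ext ⟨v, hv⟩ ⟨w, hw⟩
    have h2 : φ v ≠ w := by
      intro h2
      have := h.height_parent_lt v
      rw [h2] at this
      have hvw := hv.trans hw.symm
      rw [OrderDual.toDual_inj] at hvw
      omega
    simp [Matrix.toSquareBlock_def, h2, Matrix.one_apply, Subtype.ext_iff]
  · rw [IsRooted] at h
    push Not at h
    obtain ⟨v₀, hv₀⟩ := h
    set P : V → Prop := fun v => ∀ k, (parentStep φ)^[k] v ≠ r with hP
    have hPr : ¬ P r := fun h => h 0 rfl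
    have hPφ : ∀ v : {v : V // v ≠ r}, P (φ v) ↔ P v := by
      intro v
      rw [hP]
      constructor
      · intro h k
        cases k with
        | zero => exact v.2
        | succ k => rw [Function.iterate_succ_apply, parentStep_of_ne]; exact h k
      · intro h k
        have := h (k + 1)
        rwa [Function.iterate_succ_apply, parentStep_of_ne] at this
    rw [← Matrix.exists_mulVec_eq_zero_iff]
    refine ⟨fun v => if P v then 1 else 0, ?_, ?_⟩
    · intro h0
      have hne : v₀ ≠ r := hv₀ 0
      have := congrFun h0 ⟨v₀, hne⟩
      have hPv : P v₀ := hv₀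
      simp [hPv] at this
    · ext v
      have h1 : ∀ x : V, ∑ w : {v : V // v ≠ r},
          (if x = (w : V) then (1 : R) else 0) * (if P w then 1 else 0) = if P x then 1 else 0 := by
        intro x
        by_cases hx : x = r
        · subst hx
          rw [if_neg hPr]
          refine Finset.sum_eq_zero fun w _ => ?_
          rw [if_neg (Ne.symm w.2), zero_mul]
        · rw [Finset.sum_eq_single ⟨x, hx⟩]
          · simp
          · intro w _ hw
            rw [if_neg, zero_mul]
            rintro rfl
            exact hw rfl
          · simp
      simp only [Matrix.mulVec, dotProduct, Matrix.of_apply, sub_mul, Finset.sum_sub_distrib, h1,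
        hPφ v, sub_self, Pi.zero_apply]

/-- The graph whose edges join each non-root vertex to its parent. -/
def parentGraph (φ : {v : V // v ≠ r} → V) : SimpleGraph V :=
  SimpleGraph.fromRel fun v w => ∃ h : v ≠ r, φ ⟨v, h⟩ = w

lemma IsRooted.parentGraph_adj {φ : {v : V // v ≠ r} → V} (h : IsRooted φ)
    (v : {v : V // v ≠ r}) : (parentGraph φ).Adj v (φ v) := by
  rw [parentGraph, SimpleGraph.fromRel_adj]
  refine ⟨fun h0 => ?_, Or.inl ⟨v.2, rfl⟩⟩
  have := h.height_parent_lt v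
  rw [← h0] at this
  exact lt_irrefl _ this

lemma IsRooted.isTree_parentGraph [Fintype V] {φ : {v : V // v ≠ r} → V} (h : IsRooted φ) :
    (parentGraph φ).IsTree := by
  classical
  have hc : (parentGraph φ).Connected := by
    have hr : ∀ v, (parentGraph φ).Reachable v r :=
      h.induction (Reachable.refl r) fun v hv => (h.parentGraph_adj v).reachable.trans hv
    have : Nonempty V := ⟨r⟩
    exact ⟨fun v w => (hr v).trans (hr w).symm⟩
  rw [isTree_iff_connected_and_card]
  refine ⟨hc, le_antisymm ?_ hc.card_vert_le_card_edgeSet_add_one⟩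
  have hsub : (parentGraph φ).edgeSet ⊆ Set.range fun v : {v : V // v ≠ r} => s((v : V), φ v) := by
    intro e he
    induction e with
    | h v w =>
      rw [mem_edgeSet, parentGraph, fromRel_adj] at he
      rcases he.2 with ⟨h1, h2⟩ | ⟨h1, h2⟩
      · exact ⟨⟨v, h1⟩, by simp [h2]⟩
      · exact ⟨⟨w, h1⟩, by simp [h2, Sym2.eq_swap]⟩
  have h1 := Set.ncard_le_ncard hsub (Set.toFinite _)
  have h2 : (Set.range fun v : {v : V // v ≠ r} => s((v : V), φ v)).ncard
      ≤ Nat.card {v : V // v ≠ r} := by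
    rw [← Set.image_univ, ← Set.ncard_univ]
    exact Set.ncard_image_le (Set.toFinite _)
  have h3 : Nat.card {v : V // v ≠ r} + 1 = Nat.card V := by
    have := Fintype.card_pos_iff.2 ⟨r⟩
    rw [Nat.card_eq_fintype_card, Nat.card_eq_fintype_card, Fintype.card_subtype_compl,
      Fintype.card_subtype_eq]
    omega
  rw [Nat.card_coe_set_eq]
  omega

/-- A disagreement at v forces ψ to traverse the edge from v to φ v backwards. Agreement at φ v
would then contradict the decrease of heights, so disagreement climbs to the root, which has no
parent to disagree about. -/
lemma IsRooted.eq_of_parentGraph_eq {φ ψ : {v : V // v ≠ r} → V} (hφ : IsRooted φ)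
    (he : parentGraph φ = parentGraph ψ) : φ = ψ := by
  by_contra hne
  obtain ⟨v₀, hv₀⟩ := Function.ne_iff.1 hne
  have := hφ.root_of_closed (P := fun v => ∃ h : v ≠ r, φ ⟨v, h⟩ ≠ ψ ⟨v, h⟩) ?_ ⟨v₀.2, hv₀⟩
  · exact this.1 rfl
  · rintro v ⟨_, hv⟩
    have hadj := hφ.parentGraph_adj v
    rw [he, parentGraph, fromRel_adj] at hadj
    rcases hadj.2 with ⟨_, h2⟩ | ⟨h1, h2⟩
    · exact absurd h2.symm hv
    · refine ⟨h1, fun h3 => ?_⟩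
      have l1 := hφ.height_parent_lt v
      have l2 := hφ.height_parent_lt ⟨φ v, h1⟩
      rw [h3, h2] at l2
      exact lt_asymm l1 l2

/-- Take as parent the next vertex on a shortest walk to the root. The resulting tree lies inside
`T` and has as many edges, so the two coincide. -/
lemma exists_isRooted_of_isTree [Fintype V] {T : SimpleGraph V} (hT : T.IsTree) (r : V) :
    ∃ φ : {v : V // v ≠ r} → V, (∀ v : {v : V // v ≠ r}, T.Adj v (φ v)) ∧ IsRooted φ ∧ parentGraph φ = T := by
  classical
  have hex : ∀ v : {v : V // v ≠ r}, ∃ w, T.Adj v w ∧ T.dist w r < T.dist v r := by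
    rintro ⟨v, hv⟩
    obtain ⟨p, hp⟩ := hT.connected.exists_walk_length_eq_dist v r
    cases p with
    | nil => exact absurd rfl hv
    | cons hadj q =>
      refine ⟨_, hadj, ?_⟩
      change _ < T.dist v r
      have := T.dist_le q
      simp only [Walk.length_cons] at hp
      omega
  choose φ hadj hlt using hex
  have hroot : IsRooted φ := by
    intro v
    induction hd : T.dist v r using Nat.strong_induction_on generalizing v with
    | _ d ih =>
      by_cases hv : v = r
      · exact ⟨0, hv⟩
      · obtain ⟨k, hk⟩ := ih _ (hd ▸ hlt ⟨v, hv⟩) _ rfl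
        exact ⟨k + 1, by rw [Function.iterate_succ_apply, parentStep_of_ne φ ⟨v, hv⟩, hk]⟩
  refine ⟨φ, hadj, hroot, ?_⟩
  have hle : parentGraph φ ≤ T := by
    intro v w hvw
    rw [parentGraph, fromRel_adj] at hvw
    rcases hvw.2 with ⟨h1, rfl⟩ | ⟨h1, rfl⟩
    · exact hadj ⟨v, h1⟩
    · exact (hadj ⟨w, h1⟩).symm
  have h1 := (isTree_iff_connected_and_card.1 hroot.isTree_parentGraph).2
  have h2 := (isTree_iff_connected_and_card.1 hT).2
  rw [Nat.card_coe_set_eq] at h1 h2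
  exact edgeSet_injective (Set.eq_of_subset_of_ncard_le (edgeSet_mono hle) (by omega)
    (Set.toFinite _))

open Classical in
/-- The matrix-tree theorem: every principal cofactor of the Laplacian counts the spanning
trees. -/
theorem det_lapMatrix_submatrix_ne [Fintype V] (G : SimpleGraph V) (R : Type*)
    [CommRing R] [IsDomain R] (r : V) :
    ((G.lapMatrix R).submatrix (fun k : {k : V // k ≠ r} => (k : V))
      (fun k : {k : V // k ≠ r} => (k : V))).det = G.complexity := by
  -- Row v is the sum of e_v - e_x over the neighbours x of v, with e_r = 0. Multilinearity then
  -- turns the determinant into a sum over all choices of a neighbour as parent, and exactly the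
  -- rooted choices contribute 1.
  have hrow : (G.lapMatrix R).submatrix (fun k : {k : V // k ≠ r} => (k : V))
      (fun k : {k : V // k ≠ r} => (k : V))
      = fun v : {v : V // v ≠ r} => ∑ x ∈ G.neighborFinset (v : V), fun w : {v : V // v ≠ r} =>
        ((if (v : V) = w then 1 else 0) - (if x = w then 1 else 0) : R) := by
    ext v w
    simp [lapMatrix, degMatrix, Matrix.diagonal_apply, adjMatrix_apply, Finset.sum_apply,
      Finset.sum_sub_distrib]
  rw [hrow]
  change Matrix.detRowAlternating.toMultilinearMap _ = _
  rw [MultilinearMap.map_sum_finset]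
  change ∑ φ ∈ Fintype.piFinset fun v : {v : V // v ≠ r} => G.neighborFinset (v : V), (Matrix.of fun v w : {v : V // v ≠ r} =>
      ((if (v : V) = w then 1 else 0) - (if φ v = w then 1 else 0) : R)).det = _
  simp only [det_one_sub_parent]
  rw [Finset.sum_boole, complexity]
  congr 1
  rw [← Set.ncard_coe_finset]
  refine Set.ncard_congr (fun φ _ => parentGraph φ) ?_ ?_ ?_
  · intro φ hφ
    simp only [Finset.coe_filter, Fintype.mem_piFinset, mem_neighborFinset, Set.mem_ofPred_eq] at hφ
    refine ⟨?_, hφ.2.isTree_parentGraph⟩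
    intro v w hvw
    rw [parentGraph, fromRel_adj] at hvw
    rcases hvw.2 with ⟨h1, rfl⟩ | ⟨h1, rfl⟩
    · exact hφ.1 ⟨v, h1⟩
    · exact (hφ.1 ⟨w, h1⟩).symm
  · intro φ ψ hφ _ he
    simp only [Finset.coe_filter, Set.mem_ofPred_eq] at hφ
    exact hφ.2.eq_of_parentGraph_eq he
  · rintro T ⟨hTG, hT⟩
    obtain ⟨φ, h1, h2, h3⟩ := exists_isRooted_of_isTree hT r
    refine ⟨φ, ?_, h3⟩
    simp only [Finset.coe_filter, Fintype.mem_piFinset, mem_neighborFinset, Set.mem_ofPred_eq]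
    exact ⟨fun v => hTG (h1 v), h2⟩

lemma Connected.complexity_pos [Finite V] {G : SimpleGraph V} (hG : G.Connected) :
    0 < G.complexity := by
  obtain ⟨T, hT⟩ := hG.exists_isTree_le
  exact (Set.ncard_pos (Set.toFinite _)).2 ⟨T, hT⟩

end SimpleGraph

/-! ### Principal minor expansions and their low-order coefficients -/

open Classical in
/-- Expansion of `det (A + diagonal d)` along the principal minors of `A`. -/
theorem Matrix.det_add_diagonal {V R : Type*} [Fintype V] [CommRing R] (A : Matrix V V R)
    (d : V → R) :
    (A + Matrix.diagonal d).det = ∑ s : Finset V, (∏ i ∈ s, d i) *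
      (A.submatrix (fun k : {k : V // k ∉ s} => (k : V))
        (fun k : {k : V // k ∉ s} => (k : V))).det := by
  rw [add_comm]
  refine (Matrix.detRowAlternating.toMultilinearMap.map_add_univ (Matrix.diagonal d) A).trans ?_
  refine Finset.sum_congr rfl fun s _ => ?_
  change (Matrix.of fun i => if i ∈ s then Matrix.diagonal d i else A i).det = _
  rw [Matrix.twoBlockTriangular_det' _ (fun i => i ∈ s)]
  · congr 1
    · have : Matrix.toSquareBlockProp
          (Matrix.of fun i => if i ∈ s then Matrix.diagonal d i else A i) (fun i => i ∈ s)
          = Matrix.diagonal fun i : {i // i ∈ s} => d i := by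
        ext i j
        rw [Matrix.toSquareBlockProp_def, Matrix.of_apply, Matrix.of_apply, if_pos i.2]
        simp only [Matrix.diagonal_apply, ← Subtype.ext_iff]
      rw [this]
      convert (Matrix.det_diagonal (d := fun i : {i // i ∈ s} => d i)).trans
        (Finset.prod_coe_sort s d)
    · congr 1
      ext i j
      simp [Matrix.toSquareBlockProp_def, i.2]
  · intro i hi j hj
    simp only [Matrix.of_apply, hi, if_true]
    exact Matrix.diagonal_apply_ne _ (by rintro rfl; exact hj hi)

open Classical in
lemma Finset.sum_sum_ite_ne_eq_two_mul_sum_powersetCard {V K : Type*} [Fintype V] [CommSemiring K]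
    (F : Finset V → K) :
    ∑ i : V, ∑ j : V, (if i = j then 0 else F {i, j})
      = 2 * ∑ s ∈ Finset.univ.powersetCard 2, F s := by
  have h1 : ∑ i : V, ∑ j : V, (if i = j then 0 else F {i, j})
      = ∑ p ∈ (Finset.univ : Finset V).offDiag, F {p.1, p.2} := by
    rw [← Finset.sum_product', Finset.univ_product_univ]
    have : (Finset.univ : Finset V).offDiag = Finset.univ.filter fun p : V × V => ¬ p.1 = p.2 := by
      ext p; simp
    rw [this, Finset.sum_filter]
    refine Finset.sum_congr rfl fun p _ => ?_
    by_cases h : p.1 = p.2 <;> simp [h]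
  rw [h1, ← Finset.sum_fiberwise_of_maps_to (s := (Finset.univ : Finset V).offDiag)
    (t := Finset.univ.powersetCard 2) (g := fun p : V × V => ({p.1, p.2} : Finset V)), Finset.mul_sum]
  · refine Finset.sum_congr rfl fun s hs => ?_
    rw [Finset.mem_powersetCard] at hs
    have h2 : (Finset.univ : Finset V).offDiag.filter (fun p => ({p.1, p.2} : Finset V) = s)
        = s.offDiag := by
      obtain ⟨a, b, hab, rfl⟩ := Finset.card_eq_two.1 hs.2
      ext ⟨x, y⟩
      simp only [Finset.mem_filter, Finset.mem_offDiag, Finset.mem_univ, true_and,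
        Finset.mem_insert, Finset.mem_singleton]
      constructor
      · rintro ⟨hxy, h⟩
        have hx : x ∈ ({a, b} : Finset V) := h ▸ by simp
        have hy : y ∈ ({a, b} : Finset V) := h ▸ by simp
        simp only [Finset.mem_insert, Finset.mem_singleton] at hx hy
        exact ⟨hx, hy, hxy⟩
      · rintro ⟨rfl | rfl, rfl | rfl, h⟩
        · exact absurd rfl h
        · exact ⟨h, rfl⟩
        · exact ⟨h, Finset.pair_comm _ _⟩
        · exact absurd rfl h
    have h3 : ∀ p ∈ (Finset.univ : Finset V).offDiag.filter
        (fun p => ({p.1, p.2} : Finset V) = s), F {p.1, p.2} = F s := by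
      intro p hp
      rw [(Finset.mem_filter.1 hp).2]
    rw [Finset.sum_congr rfl h3, Finset.sum_const, h2, Finset.offDiag_card, hs.2]
    simp
  · intro p hp
    rw [Finset.mem_offDiag] at hp
    rw [Finset.mem_powersetCard]
    exact ⟨Finset.subset_univ _, Finset.card_pair hp.2.2⟩

section PolynomialDeterminant

open Polynomial

variable {V R : Type*} [Fintype V] [CommRing R]

-- The factor X^|s| is kept explicit because it leaves only sets of size at most j in the
-- coefficient of X^j.
open Classical in
lemma Matrix.det_smul_map_C_add_diagonal (A : Matrix V V R) (t : R[X]) (y : V → R[X]) :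
    (t • A.map C + Matrix.diagonal fun i => X * y i).det
      = ∑ s : Finset V, X ^ s.card * ((∏ i ∈ s, y i) * t ^ (Fintype.card V - s.card) *
        C (A.submatrix (fun k : {k : V // k ∉ s} => (k : V))
          (fun k : {k : V // k ∉ s} => (k : V))).det) := by
  rw [Matrix.det_add_diagonal]
  refine Finset.sum_congr rfl fun s _ => ?_
  have h : (t • A.map C).submatrix (fun k : {k : V // k ∉ s} => (k : V))
      (fun k : {k : V // k ∉ s} => (k : V))
      = t • (C.mapMatrix (A.submatrix (fun k : {k : V // k ∉ s} => (k : V))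
          (fun k : {k : V // k ∉ s} => (k : V)))) := by
    ext i j; simp
  rw [h, Matrix.det_smul, ← RingHom.map_det, Finset.prod_mul_distrib, Finset.prod_const]
  have hc : Fintype.card {k : V // k ∉ s} = Fintype.card V - s.card := by
    rw [Fintype.card_subtype_compl, Fintype.card_coe]
  rw [hc]
  ring

open Classical in
lemma Matrix.submatrix_notMem_singleton_det (A : Matrix V V R) (i : V) :
    (A.submatrix (fun k : {k : V // k ∉ ({i} : Finset V)} => (k : V))
          (fun k : {k : V // k ∉ ({i} : Finset V)} => (k : V))).det
    = (A.submatrix (fun k : {k : V // k ≠ i} => (k : V))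
          (fun k : {k : V // k ≠ i} => (k : V))).det := by
  rw [← Matrix.det_submatrix_equiv_self (Equiv.subtypeEquivRight
    (fun k : V => (by simp : k ≠ i ↔ k ∉ ({i} : Finset V))))]
  rfl

open Classical in
lemma Matrix.submatrix_notMem_pair_det (A : Matrix V V R) (i j : V) :
    (A.submatrix (fun k : {k : V // k ∉ ({i, j} : Finset V)} => (k : V))
          (fun k : {k : V // k ∉ ({i, j} : Finset V)} => (k : V))).det
    = (A.submatrix (fun k : {k : V // k ≠ i ∧ k ≠ j} => (k : V))
          (fun k : {k : V // k ≠ i ∧ k ≠ j} => (k : V))).det := by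
  rw [← Matrix.det_submatrix_equiv_self (Equiv.subtypeEquivRight
    (fun k : V => (by simp : k ≠ i ∧ k ≠ j ↔ k ∉ ({i, j} : Finset V))))]
  rfl

open Classical in
lemma Matrix.coeff_one_det_smul_map_C_add_diagonal (A : Matrix V V R) (hA : A.det = 0)
    (t : R[X]) (y : V → R[X]) :
    (t • A.map C + Matrix.diagonal fun i => X * y i).det.coeff 1
      = ∑ i, (y i * t ^ (Fintype.card V - 1)).coeff 0 *
        (A.submatrix (fun k : {k : V // k ≠ i} => (k : V))
          (fun k : {k : V // k ≠ i} => (k : V))).det := by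
  rw [Matrix.det_smul_map_C_add_diagonal, finsetSum_coeff]
  simp only [coeff_X_pow_mul', coeff_mul_C]
  rw [← Finset.sum_subset (Finset.subset_univ (Finset.univ.powersetCard 1)),
    Finset.powersetCard_one, Finset.sum_map]
  · simp [← Matrix.submatrix_notMem_singleton_det]
  · intro s _ hs
    have hs1 : s.card ≠ 1 := by
      intro h; exact hs (Finset.mem_powersetCard.2 ⟨Finset.subset_univ _, h⟩)
    split_ifs with h
    · have h0 : s = ∅ := by rw [← Finset.card_eq_zero]; omega
      subst h0
      have : (A.submatrix (fun k : {k : V // k ∉ (∅ : Finset V)} => (k : V))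
          (fun k : {k : V // k ∉ (∅ : Finset V)} => (k : V))).det = A.det := by
        rw [← Matrix.det_submatrix_equiv_self (Equiv.subtypeUnivEquiv
          (p := fun k : V => k ∉ (∅ : Finset V)) (by simp)) A]
        rfl
      rw [this, hA, mul_zero]
    · rfl

-- The empty set drops out since det A = 0. Singletons already carry one X and contribute a linear
-- coefficient; pairs carry two and contribute a constant one. The factor 1/2 corrects for ordered
-- pairs.
open Classical in
lemma Matrix.coeff_two_det_smul_map_C_add_diagonal {K : Type*} [Field K] [CharZero K]
    (A : Matrix V V K) (hA : A.det = 0) (t : K[X]) (y : V → K[X]) :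
    (t • A.map C + Matrix.diagonal fun i => X * y i).det.coeff 2
      = ∑ i, (y i * t ^ (Fintype.card V - 1)).coeff 1 *
        (A.submatrix (fun k : {k : V // k ≠ i} => (k : V))
          (fun k : {k : V // k ≠ i} => (k : V))).det
      + (1 / 2) * ∑ i, ∑ j, if i = j then 0 else
          (y i * y j * t ^ (Fintype.card V - 2)).coeff 0 *
          (A.submatrix (fun k : {k : V // k ≠ i ∧ k ≠ j} => (k : V))
            (fun k : {k : V // k ≠ i ∧ k ≠ j} => (k : V))).det := by
  rw [Matrix.det_smul_map_C_add_diagonal, finsetSum_coeff]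
  simp only [coeff_X_pow_mul', coeff_mul_C]
  have hd : Disjoint ((Finset.univ : Finset V).powersetCard 1) (Finset.univ.powersetCard 2) := by
    rw [Finset.disjoint_left]
    intro s h1 h2
    rw [Finset.mem_powersetCard] at h1 h2
    omega
  rw [← Finset.sum_subset (Finset.subset_univ
    ((Finset.univ : Finset V).powersetCard 1 ∪ Finset.univ.powersetCard 2)),
    Finset.sum_union hd, Finset.powersetCard_one, Finset.sum_map]
  · congr 1
    · simp [← Matrix.submatrix_notMem_singleton_det]
    · rw [← mul_right_inj' (two_ne_zero' K), ← mul_assoc,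
        ← Finset.sum_sum_ite_ne_eq_two_mul_sum_powersetCard]
      norm_num
      refine Finset.sum_congr rfl fun i _ => Finset.sum_congr rfl fun j _ => ?_
      split_ifs with h1 h2
      · rfl
      · rw [Finset.prod_pair h1, Finset.card_pair h1, Matrix.submatrix_notMem_pair_det]
        simp [mul_coeff_zero]
      · rw [Finset.card_pair h1] at h2; omega
  · intro s _ hs
    simp only [Finset.mem_union, Finset.mem_powersetCard, Finset.subset_univ, true_and, not_or] at hs
    split_ifs with h
    · have h0 : s = ∅ := by rw [← Finset.card_eq_zero]; omega
      subst h0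
      have : (A.submatrix (fun k : {k : V // k ∉ (∅ : Finset V)} => (k : V))
          (fun k : {k : V // k ∉ (∅ : Finset V)} => (k : V))).det = A.det := by
        rw [← Matrix.det_submatrix_equiv_self (Equiv.subtypeUnivEquiv
          (p := fun k : V => k ∉ (∅ : Finset V)) (by simp)) A]
        rfl
      rw [this, hA, mul_zero]
    · rfl

end PolynomialDeterminant

/-! ### Coefficients of the Ihara and Laplacian polynomials -/

namespace SimpleGraph

open Polynomial

variable {V : Type*} [Fintype V] (G : SimpleGraph V)

open Classical in
/-- The polynomial `det (I - (1 + X) A + (1 + X)² (D - I))` in the variable `X = t - 1`. -/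
noncomputable def iharaPolynomial : ℝ[X] :=
  ((1 + X : ℝ[X]) • (G.lapMatrix ℝ).map C + Matrix.diagonal fun i =>
    X * ((1 + X) * C ((G.degree i : ℝ) - 2) + X)).det

open Classical in
/-- The polynomial `det (L + X I)`. -/
noncomputable def lapPolynomial : ℝ[X] :=
  ((1 : ℝ[X]) • (G.lapMatrix ℝ).map C + Matrix.diagonal fun _ => X * 1).det

lemma coeff_one_lapPolynomial [Nonempty V] :
    G.lapPolynomial.coeff 1 = Fintype.card V * G.complexity := by
  classical
  rw [lapPolynomial, Matrix.coeff_one_det_smul_map_C_add_diagonal _ (G.det_lapMatrix_eq_zero)]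
  simp [det_lapMatrix_submatrix_ne]

open Classical in
lemma coeff_one_iharaPolynomial [Nonempty V] :
    G.iharaPolynomial.coeff 1 = G.complexity * ∑ i, ((G.degree i : ℝ) - 2) := by
  rw [iharaPolynomial, Matrix.coeff_one_det_smul_map_C_add_diagonal _ (G.det_lapMatrix_eq_zero),
    Finset.mul_sum]
  refine Finset.sum_congr rfl fun i _ => ?_
  rw [det_lapMatrix_submatrix_ne]
  simp only [coeff_zero_eq_eval_zero]
  simp
  ring

open Classical in
lemma coeff_two_iharaPolynomial (hG : G.Connected) :
    G.iharaPolynomial.coeff 2 = G.complexity * (Fintype.card V * ∑ i, ((G.degree i : ℝ) - 2)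
      + Fintype.card V + G.kirchhoffZ) := by
  have : Nonempty V := hG.nonempty
  have hκ : (G.complexity : ℝ) ≠ 0 := by exact_mod_cast hG.complexity_pos.ne'
  obtain ⟨N, hN⟩ : ∃ N, Fintype.card V = N + 1 :=
    Nat.exists_eq_succ_of_ne_zero Fintype.card_ne_zero
  rw [iharaPolynomial, Matrix.coeff_two_det_smul_map_C_add_diagonal _ (G.det_lapMatrix_eq_zero),
    mul_add]
  congr 1
  -- The product is w(1 + X)^N + X(1 + X)^(N-1) with N = |V|, which is where both the term N Σ(d_i -
  -- 2) and the extra N come from.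
  · have h : ∀ w : ℝ, (((1 + X) * C w + X) * (1 + X) ^ (Fintype.card V - 1) : ℝ[X]).coeff 1
        = Fintype.card V * w + 1 := by
      intro w
      rw [hN, Nat.add_sub_cancel, mul_coeff_one, coeff_one_add_X_pow, coeff_one_add_X_pow]
      simp [add_mul]
      ring
    simp only [h, det_lapMatrix_submatrix_ne]
    rw [← Finset.sum_mul, Finset.sum_add_distrib, ← Finset.mul_sum]
    simp
    ring
  · rw [kirchhoffZ]
    simp only [Finset.mul_sum]
    refine Finset.sum_congr rfl fun i _ => Finset.sum_congr rfl fun j _ => ?_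
    rw [resistance]
    split_ifs with h
    · simp
    · rw [coeff_zero_eq_eval_zero]
      simp
      field_simp

end SimpleGraph

/-! ### Schur orthogonality and completeness of the irreducible representations -/

section MatrixRepresentation

variable {Γ : Type*} [Group Γ]

lemma matrixRep_apply {d : ℕ} (ρ : Γ →* Matrix (Fin d) (Fin d) ℂ) (g : Γ) (v : Fin d → ℂ) :
    matrixRep ρ g v = (ρ g).mulVec v := rfl

/-- A matrix intertwining two matrix representations, as an intertwining map. -/
noncomputable def intertwiningMapOfMatrix {d e : ℕ} (ρ : Γ →* Matrix (Fin d) (Fin d) ℂ)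
    (σ : Γ →* Matrix (Fin e) (Fin e) ℂ) (Y : Matrix (Fin d) (Fin e) ℂ)
    (hY : ∀ g, Y * σ g = ρ g * Y) : (matrixRep σ).IntertwiningMap (matrixRep ρ) :=
  Y.mulVecLin.intertwiningMap_of_isIntertwiningMap _ _ fun g v => by
    simp only [matrixRep_apply, Matrix.mulVecLin_apply, Matrix.mulVec_mulVec, hY]

lemma intertwiningMapOfMatrix_apply {d e : ℕ} (ρ : Γ →* Matrix (Fin d) (Fin d) ℂ)
    (σ : Γ →* Matrix (Fin e) (Fin e) ℂ) (Y : Matrix (Fin d) (Fin e) ℂ)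
    (hY : ∀ g, Y * σ g = ρ g * Y) (v : Fin e → ℂ) :
    intertwiningMapOfMatrix ρ σ Y hY v = Y.mulVec v := rfl

lemma isIrreducible_of_surjective {d : ℕ} [NeZero d] (σ : Γ →* Matrix (Fin d) (Fin d) ℂ)
    (hσ : Function.Surjective (MonoidAlgebra.lift ℂ (Matrix (Fin d) (Fin d) ℂ) Γ σ)) :
    (matrixRep σ).IsIrreducible := by
  rw [Representation.irreducible_iff_isSimpleModule_asModule,
    isSimpleModule_iff_toSpanSingleton_surjective]
  refine ⟨inferInstanceAs (Nontrivial (Fin d → ℂ)), fun x hx y => ?_⟩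
  have hx' : ∃ k, (matrixRep σ).asModuleEquiv x k ≠ 0 := by
    by_contra! h
    apply hx
    rw [← (matrixRep σ).asModuleEquiv.map_eq_zero_iff]
    exact funext h
  obtain ⟨k, hk⟩ := hx'
  -- This rank-one matrix sends x to y, so every nonzero vector generates the module.
  obtain ⟨r, hr⟩ := hσ (Matrix.vecMulVec ((matrixRep σ).asModuleEquiv y)
    (Pi.single k ((matrixRep σ).asModuleEquiv x k)⁻¹))
  refine ⟨r, ?_⟩
  apply (matrixRep σ).asModuleEquiv.injective
  rw [LinearMap.toSpanSingleton_apply, Representation.asModuleEquiv_map_smul]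
  have h1 : ∀ r, (matrixRep σ).asAlgebraHom r
      = Matrix.toLinAlgEquiv' (MonoidAlgebra.lift ℂ (Matrix (Fin d) (Fin d) ℂ) Γ σ r) := by
    intro r
    induction r using MonoidAlgebra.induction_linear with
    | zero => simp
    | add a b ha hb => simp [ha, hb]
    | single g c =>
      rw [Representation.asAlgebraHom_single, MonoidAlgebra.lift_single, map_smul]
      rfl
  rw [h1, hr]
  ext i
  rw [Matrix.toLinAlgEquiv'_apply, Matrix.vecMulVec_mulVec]
  simp [hk]

variable [Fintype Γ]

lemma sum_conj_intertwines {d e : ℕ} (ρ : Γ →* Matrix (Fin d) (Fin d) ℂ)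
    (σ : Γ →* Matrix (Fin e) (Fin e) ℂ) (X : Matrix (Fin d) (Fin e) ℂ) (h : Γ) :
    (∑ g, ρ g * X * σ g⁻¹) * σ h = ρ h * ∑ g, ρ g * X * σ g⁻¹ := by
  rw [Matrix.sum_mul, Matrix.mul_sum]
  refine Fintype.sum_equiv (Equiv.mulLeft h⁻¹) _ _ fun g => ?_
  simp only [Equiv.coe_mulLeft, mul_inv_rev, inv_inv, map_mul, Matrix.mul_assoc]
  rw [← Matrix.mul_assoc (ρ h) (ρ h⁻¹), ← map_mul ρ h h⁻¹, mul_inv_cancel, map_one, Matrix.one_mul]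

lemma sum_mul_single_mul_apply {d e : ℕ} (ρ : Γ →* Matrix (Fin d) (Fin d) ℂ)
    (σ : Γ →* Matrix (Fin e) (Fin e) ℂ) (a b : Fin d) (c k : Fin e) :
    (∑ g, ρ g * Matrix.single b c (1 : ℂ) * σ g⁻¹) a k = ∑ g, ρ g a b * σ g⁻¹ c k := by
  rw [Matrix.sum_apply]
  refine Finset.sum_congr rfl fun g _ => ?_
  rw [Matrix.mul_apply, Finset.sum_eq_single c]
  · simp
  · intro x _ hx
    rw [Matrix.mul_single_apply_of_ne _ _ _ _ _ hx, zero_mul]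
  · simp

/-- The sum is an entry of a matrix unit averaged over the group, which is an intertwiner and so
vanishes by Schur's lemma. -/
lemma sum_matrixCoeff_mul_of_not_equiv {d e : ℕ} (ρ : Γ →* Matrix (Fin d) (Fin d) ℂ)
    (σ : Γ →* Matrix (Fin e) (Fin e) ℂ) (hρ : (matrixRep ρ).IsIrreducible)
    (hσ : (matrixRep σ).IsIrreducible) (hne : ¬ Nonempty ((matrixRep σ).Equiv (matrixRep ρ)))
    (a b : Fin d) (c k : Fin e) : ∑ g, ρ g a b * σ g⁻¹ c k = 0 := by
  rw [← sum_mul_single_mul_apply]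
  set Y := ∑ g, ρ g * Matrix.single b c (1 : ℂ) * σ g⁻¹ with hYdef
  have hY : ∀ g, Y * σ g = ρ g * Y := sum_conj_intertwines ρ σ _
  rcases Representation.IsIrreducible.bijective_or_eq_zero (intertwiningMapOfMatrix ρ σ Y hY)
    with h | h
  · exact absurd ⟨(intertwiningMapOfMatrix ρ σ Y hY).ofBijective h⟩ hne
  · have h1 := congrArg (fun F => F (Pi.single k 1)) h
    have h2 : Y.mulVec (Pi.single k 1) = 0 := h1
    have h3 := congrFun h2 a
    simpa using h3

/-- Here the averaged matrix unit is a scalar matrix by Schur's lemma over ℂ, and its trace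
determines the scalar. -/
lemma sum_matrixCoeff_mul_self {d : ℕ} (ρ : Γ →* Matrix (Fin d) (Fin d) ℂ)
    (hρ : (matrixRep ρ).IsIrreducible) (a b c k : Fin d) :
    d * ∑ g, ρ g a b * ρ g⁻¹ c k = if a = k ∧ b = c then (Fintype.card Γ : ℂ) else 0 := by
  rw [← sum_mul_single_mul_apply]
  set Y := ∑ g, ρ g * Matrix.single b c (1 : ℂ) * ρ g⁻¹ with hYdef
  have hY : ∀ g, Y * ρ g = ρ g * Y := sum_conj_intertwines ρ ρ _
  obtain ⟨z, hz⟩ := (Representation.IsIrreducible.algebraMap_intertwiningMap_bijective_of_isAlgClosed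
    (ρ := matrixRep ρ)).2 (intertwiningMapOfMatrix ρ ρ Y hY)
  have hYz : Y = z • (1 : Matrix (Fin d) (Fin d) ℂ) := by
    refine Matrix.ext_of_mulVec_single fun i => ?_
    rw [← intertwiningMapOfMatrix_apply ρ ρ Y hY, ← hz, Matrix.smul_mulVec, Matrix.one_mulVec]
    rfl
  have htr : Y.trace = if b = c then (Fintype.card Γ : ℂ) else 0 := by
    rw [hYdef, Matrix.trace_sum]
    have : ∀ g : Γ, (ρ g * Matrix.single b c (1 : ℂ) * ρ g⁻¹).trace = if b = c then 1 else 0 := by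
      intro g
      rw [Matrix.trace_mul_comm, ← Matrix.mul_assoc, ← map_mul, inv_mul_cancel, map_one,
        Matrix.one_mul]
      split_ifs with h
      · subst h; simp
      · exact Matrix.trace_single_eq_of_ne _ _ _ h
    simp only [this]
    split_ifs <;> simp
  have hz2 : (d : ℂ) * z = if b = c then (Fintype.card Γ : ℂ) else 0 := by
    rw [← htr, hYz]
    simp [mul_comm]
  rw [hYz, Matrix.smul_apply, smul_eq_mul, ← mul_assoc, hz2, Matrix.one_apply]
  by_cases h1 : a = k <;> by_cases h2 : b = c <;> simp [h1, h2]

end MatrixRepresentation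

namespace IsCompleteIrreducibleList

variable {Γ ι : Type*} [Group Γ] [Fintype Γ] {f : ι → ℕ}
  {ρ : (i : ι) → Γ →* Matrix (Fin (f i)) (Fin (f i)) ℂ}

/-- The irreducible representations separate the elements of the group algebra. -/
lemma eq_zero_of_forall_sum_smul_eq_zero (hρ : IsCompleteIrreducibleList f ρ) (c : Γ → ℂ)
    (hc : ∀ i, ∑ g, c g • ρ i g = 0) : c = 0 := by
  have : NeZero (Nat.card Γ : ℂ) := ⟨by exact_mod_cast Nat.card_pos.ne'⟩
  have : IsSemisimpleRing (MonoidAlgebra ℂ Γ) := inferInstance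
  have : FiniteDimensional ℂ (MonoidAlgebra ℂ Γ) :=
    inferInstance
  -- By Wedderburn's theorem the group algebra is a product of matrix algebras. Projection to a
  -- factor is an irreducible representation, hence equivalent to some `ρ i`, so it kills the
  -- element; all components being zero, so is the element.
  obtain ⟨N, d, hd, ⟨e⟩⟩ :=
    IsSemisimpleRing.exists_algEquiv_pi_matrix_of_isAlgClosed ℂ (MonoidAlgebra ℂ Γ)
  set r : MonoidAlgebra ℂ Γ := ∑ g, MonoidAlgebra.single g (c g) with hr
  have her : e r = 0 := by
    ext1 j
    set π : MonoidAlgebra ℂ Γ →ₐ[ℂ] Matrix (Fin (d j)) (Fin (d j)) ℂ :=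
      (Pi.evalAlgHom ℂ _ j).comp e.toAlgHom with hπ
    set σ : Γ →* Matrix (Fin (d j)) (Fin (d j)) ℂ :=
      (MonoidAlgebra.lift ℂ _ Γ).symm π with hσ
    have hlift : MonoidAlgebra.lift ℂ (Matrix (Fin (d j)) (Fin (d j)) ℂ) Γ σ = π :=
      Equiv.apply_symm_apply _ _
    have hirr : (matrixRep σ).IsIrreducible := by
      have := hd j
      apply isIrreducible_of_surjective
      rw [hlift]
      intro y
      obtain ⟨x, hx⟩ := e.surjective (Pi.single j y)
      refine ⟨x, ?_⟩
      simp [hπ, hx]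
    obtain ⟨i, ⟨E⟩⟩ := hρ.complete _ σ hirr
    have h1 : ∑ g, c g • matrixRep (ρ i) g = 0 := by
      ext1 v
      have := congrArg (fun M => M.mulVec (Pi.single v (1:ℂ))) (hc i)
      ext k
      have := congrFun this k
      simpa [LinearMap.sum_apply, matrixRep_apply, Matrix.sum_apply] using this
    have h2 : ∑ g, c g • matrixRep σ g = 0 := by
      have h : ∀ g, matrixRep σ g = E.symm.conj (matrixRep (ρ i) g) := fun g =>
        (E.symm.conj_apply_self g).symm
      simp only [h, ← map_smul, ← map_sum, h1, map_zero]
    have h3 : π r = ∑ g, c g • σ g := by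
      rw [← hlift, hr, map_sum]
      simp only [MonoidAlgebra.lift_single]
    change π r = 0
    rw [h3]
    apply Matrix.toLinAlgEquiv'.injective
    rw [map_sum, map_zero]
    simp only [map_smul]
    exact h2
  have hr0 : r = 0 := by simpa using her
  ext g
  have := congrArg (fun x => x.coeff g) hr0
  classical
  simpa [hr, Finsupp.single_apply] using this

/-- The matrix of all matrix coefficients of the irreducible representations. -/
def coeffMatrix (ρ : (i : ι) → Γ →* Matrix (Fin (f i)) (Fin (f i)) ℂ) :
    Matrix Γ (Σ i, Fin (f i) × Fin (f i)) ℂ :=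
  Matrix.of fun g x => ρ x.1 g x.2.1 x.2.2

/-- The inverse of `coeffMatrix` for a complete list of irreducible representations. -/
noncomputable def coeffMatrixInv (ρ : (i : ι) → Γ →* Matrix (Fin (f i)) (Fin (f i)) ℂ) :
    Matrix (Σ i, Fin (f i) × Fin (f i)) Γ ℂ :=
  Matrix.of fun x g => (f x.1 : ℂ) / Fintype.card Γ * ρ x.1 g⁻¹ x.2.2 x.2.1

lemma coeffMatrixInv_mul_coeffMatrix [DecidableEq ι] (hρ : IsCompleteIrreducibleList f ρ) :
    coeffMatrixInv ρ * coeffMatrix ρ = 1 := by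
  have hΓ : (Fintype.card Γ : ℂ) ≠ 0 := by exact_mod_cast Fintype.card_ne_zero
  ext ⟨i, a, b⟩ ⟨j, c, k⟩
  have h1 : (coeffMatrixInv ρ * coeffMatrix ρ) ⟨i, a, b⟩ ⟨j, c, k⟩
      = (f i : ℂ) / Fintype.card Γ * ∑ g, ρ j g c k * ρ i g⁻¹ b a := by
    rw [Matrix.mul_apply, Finset.mul_sum]
    refine Finset.sum_congr rfl fun g _ => ?_
    simp only [coeffMatrixInv, coeffMatrix, Matrix.of_apply]
    ring
  rw [h1]
  by_cases hij : i = j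
  · subst hij
    rw [div_mul_eq_mul_div, sum_matrixCoeff_mul_self _ (hρ.irreducible i), Matrix.one_apply]
    by_cases h2 : c = a ∧ k = b
    · obtain ⟨rfl, rfl⟩ := h2
      simp [hΓ]
    · rw [if_neg h2, if_neg, zero_div]
      intro h
      simp only [Sigma.mk.injEq, heq_eq_eq, Prod.mk.injEq, true_and] at h
      exact h2 ⟨h.1.symm, h.2.symm⟩
  · rw [sum_matrixCoeff_mul_of_not_equiv _ _ (hρ.irreducible j) (hρ.irreducible i)
      (fun h => hij (hρ.inequivalent _ _ h)), mul_zero, Matrix.one_apply_ne]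
    intro h
    exact hij (congrArg Sigma.fst h)

lemma coeffMatrix_mul_coeffMatrixInv [Fintype ι] [DecidableEq ι] [DecidableEq Γ]
    (hρ : IsCompleteIrreducibleList f ρ) : coeffMatrix ρ * coeffMatrixInv ρ = 1 := by
  -- This avoids proving Σ f_i² = |Γ| first: each row of the left factor is a group-algebra element
  -- killed by every `ρ i`, hence zero.
  have h1 : (coeffMatrix ρ * coeffMatrixInv ρ - 1) * coeffMatrix ρ = 0 := by
    rw [Matrix.sub_mul, Matrix.mul_assoc, hρ.coeffMatrixInv_mul_coeffMatrix, Matrix.mul_one,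
      Matrix.one_mul, sub_self]
  rw [← sub_eq_zero]
  ext h g
  refine congrFun (hρ.eq_zero_of_forall_sum_smul_eq_zero
    (fun g => (coeffMatrix ρ * coeffMatrixInv ρ - 1 : Matrix Γ Γ ℂ) h g) fun i => ?_) g
  ext a b
  have h2 := congrFun (congrFun h1 h) ⟨i, a, b⟩
  rw [Matrix.mul_apply] at h2
  simpa [Matrix.sum_apply, coeffMatrix] using h2

end IsCompleteIrreducibleList

theorem Matrix.det_blockDiagonal' {o R : Type*} {m : o → Type*} [Fintype o] [DecidableEq o]
    [∀ i, Fintype (m i)] [∀ i, DecidableEq (m i)] [CommRing R] (M : (i : o) → Matrix (m i) (m i) R) :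
    (Matrix.blockDiagonal' M).det = ∏ i, (M i).det := by
  let _ : LinearOrder o := LinearOrder.lift' (Fintype.equivFin o) (Fintype.equivFin o).injective
  rw [(Matrix.blockTriangular_blockDiagonal' M).det_fintype]
  refine Finset.prod_congr rfl fun i _ => ?_
  rw [← Matrix.det_submatrix_equiv_self (Equiv.sigmaSubtype i).symm]
  congr 1
  ext x y
  exact Matrix.blockDiagonal'_apply_eq M i x y

/-! ### Factorization of determinants over a covering -/

namespace VoltageAssignment

variable {V : Type*} {G : SimpleGraph V} {Γ : Type*} [Group Γ]

open Classical in
lemma degree_derivedGraph [Fintype V] [Fintype Γ] (α : VoltageAssignment G Γ) (p : V × Γ) :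
    α.derivedGraph.degree p = G.degree p.1 := by
  rw [← SimpleGraph.card_neighborFinset_eq_degree, ← SimpleGraph.card_neighborFinset_eq_degree]
  refine Finset.card_bij (fun q _ => q.1) ?_ ?_ ?_
  · intro q hq
    rw [SimpleGraph.mem_neighborFinset] at hq ⊢
    exact hq.1
  · rintro ⟨v, k⟩ hq ⟨w, l⟩ hq' h
    rw [SimpleGraph.mem_neighborFinset] at hq hq'
    obtain ⟨h1, h2⟩ := hq
    obtain ⟨h3, h4⟩ := hq'
    simp only at h h2 h4
    subst h
    rw [h2, h4]
  · intro w hw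
    rw [SimpleGraph.mem_neighborFinset] at hw
    refine ⟨(w, p.2 * α.val ⟨(p.1, w), hw⟩), ?_, rfl⟩
    rw [SimpleGraph.mem_neighborFinset]
    exact ⟨hw, rfl⟩

open Classical in
lemma adjMatrix_derivedGraph_apply (α : VoltageAssignment G Γ) (u v : V) (h g : Γ) :
    α.derivedGraph.adjMatrix ℂ (u, h) (v, h * g) = α.adjPart g u v := by
  rw [SimpleGraph.adjMatrix_apply, adjPart, Matrix.of_apply]
  congr 1
  simp [derivedGraph, eq_comm]

/-- The reindexing that groups the coordinates of `V × ⊔ i, f i × f i` by representation and row. -/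
def blockEquiv (V : Type*) {ι : Type*} (f : ι → ℕ) :
    (Σ i, (Fin (f i) × V) × Fin (f i)) ≃ V × (Σ i, Fin (f i) × Fin (f i)) where
  toFun x := (x.2.1.2, ⟨x.1, (x.2.2, x.2.1.1)⟩)
  invFun y := ⟨y.2.1, ((y.2.2.2, y.1), y.2.2.1)⟩
  left_inv _ := rfl
  right_inv _ := rfl

open Classical in
/-- The determinant of a matrix combining the adjacency matrix of a covering with a diagonal
matrix lifted from the base factors over the irreducible representations of the group. -/
theorem det_smul_adjMatrix_derivedGraph_add_diagonal [Fintype V] [Fintype Γ] {ι : Type*} [Fintype ι]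
    {f : ι → ℕ} {ρ : (i : ι) → Γ →* Matrix (Fin (f i)) (Fin (f i)) ℂ}
    (hρ : IsCompleteIrreducibleList f ρ) (α : VoltageAssignment G Γ) (b : ℂ) (c : V → ℂ) :
    (b • α.derivedGraph.adjMatrix ℂ + Matrix.diagonal fun p : V × Γ => c p.1).det
      = ∏ i, (b • ∑ g, ρ i g ⊗ₖ α.adjPart g
        + (1 : Matrix (Fin (f i)) (Fin (f i)) ℂ) ⊗ₖ Matrix.diagonal c).det ^ f i := by
  set B : (i : ι) → Matrix (Fin (f i) × V) (Fin (f i) × V) ℂ := fun i =>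
    b • ∑ g, ρ i g ⊗ₖ α.adjPart g
        + (1 : Matrix (Fin (f i)) (Fin (f i)) ℂ) ⊗ₖ Matrix.diagonal c with hB
  set M := b • α.derivedGraph.adjMatrix ℂ + Matrix.diagonal fun p : V × Γ => c p.1 with hM
  set N := Matrix.blockDiagonal' fun i => Matrix.blockDiagonal fun _ : Fin (f i) => B i with hN
  set T : Matrix (V × Γ) (Σ i, (Fin (f i) × V) × Fin (f i)) ℂ :=
    ((1 : Matrix V V ℂ) ⊗ₖ IsCompleteIrreducibleList.coeffMatrix ρ).submatrix id (blockEquiv V f)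
    with hT
  set T' : Matrix (Σ i, (Fin (f i) × V) × Fin (f i)) (V × Γ) ℂ :=
    ((1 : Matrix V V ℂ) ⊗ₖ IsCompleteIrreducibleList.coeffMatrixInv ρ).submatrix
      (blockEquiv V f) id with hT'
  have hTT' : T * T' = 1 := by
    rw [hT, hT', Matrix.submatrix_mul_equiv, ← Matrix.mul_kronecker_mul,
      hρ.coeffMatrix_mul_coeffMatrixInv, Matrix.one_mul, Matrix.one_kronecker_one,
      Matrix.submatrix_id_id]
  have hT'T : T' * T = 1 := by
    rw [hT, hT', ← Matrix.submatrix_mul _ _ _ _ _ Function.bijective_id,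
      ← Matrix.mul_kronecker_mul, hρ.coeffMatrixInv_mul_coeffMatrix, Matrix.one_mul,
      Matrix.one_kronecker_one, Matrix.submatrix_one_equiv]
  -- The entry of `T` at (u, h) and (i, (x, v), a) is δ_uv ρ_i(h)_{ax}. Expanding ρ_i(hg) =
  -- ρ_i(h)ρ_i(g) makes `M` act through `B i` on the pair (x, v). The row index a is inert, so each
  -- block occurs `f i` times.
  have hMT : M * T = T * N := by
    ext ⟨u, h⟩ ⟨i, ⟨x, v⟩, a⟩
    have hl : (M * T) (u, h) ⟨i, (x, v), a⟩ = ∑ g, M (u, h) (v, h * g) * ρ i (h * g) a x := by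
      rw [Matrix.mul_apply, Fintype.sum_prod_type, Finset.sum_eq_single v]
      · rw [← Equiv.sum_comp (Equiv.mulLeft h)]
        refine Finset.sum_congr rfl fun g _ => ?_
        simp [hT, blockEquiv, IsCompleteIrreducibleList.coeffMatrix]
      · intro w _ hw
        refine Finset.sum_eq_zero fun g _ => ?_
        simp [hT, blockEquiv, hw]
      · simp
    have hr : (T * N) (u, h) ⟨i, (x, v), a⟩ = ∑ y, ρ i h a y * B i (y, u) (x, v) := by
      rw [Matrix.mul_apply, Fintype.sum_sigma, Finset.sum_eq_single i]
      · rw [Fintype.sum_prod_type, Fintype.sum_prod_type]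
        refine Finset.sum_congr rfl fun y _ => ?_
        rw [Finset.sum_eq_single u, Finset.sum_eq_single a]
        · simp [hT, hN, blockEquiv, IsCompleteIrreducibleList.coeffMatrix]
        · intro a' _ ha'
          simp [hN, Matrix.blockDiagonal_apply, ha']
        · simp
        · intro w _ hw
          refine Finset.sum_eq_zero fun g _ => ?_
          simp [hT, blockEquiv, hw.symm]
        · simp
      · intro j _ hj
        refine Finset.sum_eq_zero fun y _ => ?_
        rw [hN, Matrix.blockDiagonal'_apply_ne _ _ _ hj, mul_zero]
      · simp
    have hMg : ∀ g, M (u, h) (v, h * g) = b * α.adjPart g u v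
        + if u = v ∧ g = 1 then c u else 0 := by
      intro g
      rw [hM, Matrix.add_apply, Matrix.smul_apply, adjMatrix_derivedGraph_apply, smul_eq_mul,
        Matrix.diagonal_apply]
      simp
    have hBy : ∀ y, B i (y, u) (x, v) = b * ∑ g, ρ i g y x * α.adjPart g u v
        + if y = x ∧ u = v then c u else 0 := by
      intro y
      simp only [hB, Matrix.add_apply, Matrix.smul_apply, Matrix.sum_apply,
        Matrix.kroneckerMap_apply, smul_eq_mul, Matrix.one_apply, Matrix.diagonal_apply]
      by_cases h1 : y = x <;> by_cases h2 : u = v <;> simp [h1, h2]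
    rw [hl, hr]
    simp only [hMg, hBy, add_mul, mul_add, Finset.sum_add_distrib]
    congr 1
    · simp only [Finset.mul_sum]
      rw [Finset.sum_comm]
      refine Finset.sum_congr rfl fun g _ => ?_
      rw [map_mul, Matrix.mul_apply, Finset.mul_sum]
      refine Finset.sum_congr rfl fun y _ => ?_
      ring
    · by_cases h2 : u = v
      · simp [h2, mul_comm]
      · simp [h2]
  have hMN : M = T * N * T' := by
    rw [← hMT, Matrix.mul_assoc, hTT', Matrix.mul_one]
  rw [hMN, Matrix.det_conj_of_mul_eq_one hTT' hT'T, hN, Matrix.det_blockDiagonal']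
  refine Finset.prod_congr rfl fun i _ => ?_
  rw [Matrix.det_blockDiagonal, Finset.prod_const, Finset.card_univ, Fintype.card_fin]

end VoltageAssignment

/-! ### Specializations of the factorization and nonnegativity at t = 1 -/

open Polynomial in
lemma Matrix.exists_polynomial_eval_eq_det {n R : Type*} [Fintype n] [DecidableEq n] [CommRing R]
    (A B Q : Matrix n n R) :
    ∃ p : R[X], ∀ t, p.eval t = (A + t • B + t ^ 2 • Q).det := by
  refine ⟨(A.map C + (X : R[X]) • B.map C + (X ^ 2 : R[X]) • Q.map C).det, fun t => ?_⟩
  rw [← coe_evalRingHom, RingHom.map_det]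
  congr 1
  ext i j
  simp
  ring

/-- A determinant is real and nonnegative if all eigenvalues of the matrix are. -/
lemma Matrix.exists_nonneg_det_of_charpoly_roots {n : Type*} [Fintype n] [DecidableEq n]
    (A : Matrix n n ℂ) (h : ∀ x ∈ A.charpoly.roots, ∃ r : ℝ, 0 ≤ r ∧ x = r) :
    ∃ r : ℝ, 0 ≤ r ∧ A.det = r := by
  rw [Matrix.det_eq_prod_roots_charpoly]
  refine Multiset.prod_induction (fun x : ℂ => ∃ r : ℝ, 0 ≤ r ∧ x = r) _ ?_ ⟨1, by simp⟩ h
  rintro _ _ ⟨r, hr, rfl⟩ ⟨s, hs, rfl⟩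
  exact ⟨r * s, mul_nonneg hr hs, by simp⟩

namespace SimpleGraph

open Polynomial

variable {V : Type*} [Fintype V] (G : SimpleGraph V)

open Classical in
lemma eval_map_iharaPolynomial (s : ℂ) :
    (G.iharaPolynomial.map (algebraMap ℝ ℂ)).eval s
      = ((-(1 + s)) • G.adjMatrix ℂ
        + Matrix.diagonal fun v => 1 + (1 + s) ^ 2 * ((G.degree v : ℂ) - 1)).det := by
  rw [eval_map, ← coe_eval₂RingHom, iharaPolynomial, RingHom.map_det]
  congr 1
  ext u v
  by_cases h : u = v
  · subst h
    simp [lapMatrix, degMatrix]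
    ring
  · by_cases hadj : G.Adj u v <;> simp [lapMatrix, degMatrix, h, adjMatrix_apply, hadj]

open Classical in
lemma eval_map_lapPolynomial (s : ℂ) :
    (G.lapPolynomial.map (algebraMap ℝ ℂ)).eval s
      = ((-1 : ℂ) • G.adjMatrix ℂ + Matrix.diagonal fun v => (G.degree v : ℂ) + s).det := by
  rw [eval_map, ← coe_eval₂RingHom, lapPolynomial, RingHom.map_det]
  congr 1
  ext u v
  by_cases h : u = v
  · subst h
    simp [lapMatrix, degMatrix]
  · by_cases hadj : G.Adj u v <;> simp [lapMatrix, degMatrix, h, adjMatrix_apply, hadj]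

lemma coeff_zero_lapPolynomial [Nonempty V] : G.lapPolynomial.coeff 0 = 0 := by
  classical
  rw [coeff_zero_eq_eval_zero, ← coe_evalRingHom, lapPolynomial, RingHom.map_det]
  rw [← G.det_lapMatrix_eq_zero]
  congr 1
  ext u v
  by_cases h : u = v <;> simp [h]

lemma coeff_zero_iharaPolynomial [Nonempty V] : G.iharaPolynomial.coeff 0 = 0 := by
  classical
  rw [coeff_zero_eq_eval_zero, ← coe_evalRingHom, iharaPolynomial, RingHom.map_det]
  rw [← G.det_lapMatrix_eq_zero]
  congr 1
  ext u v
  by_cases h : u = v <;> simp [h]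

/-- The zeros of `det (L + s I)` are real and nonpositive. -/
lemma exists_nonneg_of_eval_lapPolynomial_eq_zero (x : ℂ)
    (hx : (G.lapPolynomial.map (algebraMap ℝ ℂ)).eval (-x) = 0) : ∃ r : ℝ, 0 ≤ r ∧ x = r := by
  classical
  have hpos := G.posSemidef_lapMatrix ℝ
  have h1 : ((G.lapMatrix ℝ).charpoly.map (algebraMap ℝ ℂ)).eval x = 0 := by
    rw [← Matrix.charpoly_map, Matrix.eval_charpoly]
    have h2 : Matrix.scalar V x - (G.lapMatrix ℝ).map (algebraMap ℝ ℂ)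
        = -((-1 : ℂ) • G.adjMatrix ℂ + Matrix.diagonal fun v => (G.degree v : ℂ) + -x) := by
      ext u v
      by_cases h : u = v
      · subst h
        simp [lapMatrix, degMatrix]
        ring
      · by_cases hadj : G.Adj u v <;> simp [lapMatrix, degMatrix, h, adjMatrix_apply, hadj]
    rw [eval_map_lapPolynomial] at hx
    rw [h2, Matrix.det_neg, hx, mul_zero]
  rw [hpos.1.charpoly_eq, Polynomial.map_prod, eval_prod, Finset.prod_eq_zero_iff] at h1
  obtain ⟨i, -, hi⟩ := h1
  refine ⟨hpos.1.eigenvalues i, hpos.eigenvalues_nonneg i, ?_⟩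
  simpa [sub_eq_zero] using hi

end SimpleGraph

namespace VoltageAssignment

variable {V : Type*} {G : SimpleGraph V} {Γ : Type*} [Group Γ] [Fintype Γ]

open Classical in
lemma sum_adjPart (α : VoltageAssignment G Γ) : ∑ g, α.adjPart g = G.adjMatrix ℂ := by
  ext u v
  rw [Matrix.sum_apply, SimpleGraph.adjMatrix_apply]
  by_cases h : G.Adj u v <;> simp [adjPart, h]

variable [Fintype V]

open Classical in
lemma twistedDet_eq (α : VoltageAssignment G Γ) {d : ℕ}
    (ρ : Γ →* Matrix (Fin d) (Fin d) ℂ) (t : ℂ) :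
    α.twistedDet ρ t = ((-t) • ∑ g, ρ g ⊗ₖ α.adjPart g + (1 : Matrix (Fin d) (Fin d) ℂ) ⊗ₖ
      Matrix.diagonal fun v => 1 + t ^ 2 * ((G.degree v : ℂ) - 1)).det := by
  rw [twistedDet]
  congr 1
  have h : (1 : Matrix (Fin d) (Fin d) ℂ) ⊗ₖ
      (Matrix.diagonal fun v => 1 + t ^ 2 * ((G.degree v : ℂ) - 1))
      = 1 + t ^ 2 • ((1 : Matrix (Fin d) (Fin d) ℂ) ⊗ₖ (G.degMatrix ℂ - 1)) := by
    ext ⟨a, u⟩ ⟨b, v⟩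
    by_cases h1 : a = b <;> by_cases h2 : u = v <;>
      simp [h1, h2, SimpleGraph.degMatrix]
  rw [h, neg_smul]
  abel

open Classical in
lemma det_trivial_factor (α : VoltageAssignment G Γ) {d : ℕ} (hd : d = 1)
    (ρ : Γ →* Matrix (Fin d) (Fin d) ℂ) (hρ : ρ = 1) (b : ℂ) (c : V → ℂ) :
    (b • ∑ g, ρ g ⊗ₖ α.adjPart g + (1 : Matrix (Fin d) (Fin d) ℂ) ⊗ₖ Matrix.diagonal c).det
      = (b • G.adjMatrix ℂ + Matrix.diagonal c).det := by
  subst hd hρ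
  rw [← Matrix.det_submatrix_equiv_self (Equiv.uniqueProd V (Fin 1)).symm]
  congr 1
  rw [← sum_adjPart α]
  ext u v
  simp [Matrix.sum_apply]

variable {ι : Type*} [Fintype ι] {f : ι → ℕ}
  {ρ : (i : ι) → Γ →* Matrix (Fin (f i)) (Fin (f i)) ℂ}

-- At t = 1 the matrix is the `ρ i` block of the Laplacian of the covering, so its eigenvalues are
-- among the nonnegative Laplacian eigenvalues.
open Classical in
lemma exists_nonneg_twistedDet_one (hρ : IsCompleteIrreducibleList f ρ) (α : VoltageAssignment G Γ)
    (i : ι) : ∃ r : ℝ, 0 ≤ r ∧ α.twistedDet (ρ i) 1 = r := by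
  -- Positive degree makes the power `f i` of a vanishing block determinant vanish, so an eigenvalue
  -- of the block is one of the covering.
  have hfi : f i ≠ 0 := by
    intro h0
    have h1 := hρ.irreducible i
    have h2 : Nontrivial (matrixRep (ρ i)).asModule := by
      have := (Representation.irreducible_iff_isSimpleModule_asModule _).1 h1
      exact IsSimpleModule.nontrivial (MonoidAlgebra ℂ Γ) _
    have h3 : Subsingleton (matrixRep (ρ i)).asModule := by
      have : IsEmpty (Fin (f i)) := by rw [h0]; infer_instance
      exact inferInstanceAs (Subsingleton (Fin (f i) → ℂ))
    exact not_subsingleton _ h3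
  rw [twistedDet_eq]
  refine Matrix.exists_nonneg_det_of_charpoly_roots _ fun x hx => ?_
  apply α.derivedGraph.exists_nonneg_of_eval_lapPolynomial_eq_zero
  rw [SimpleGraph.eval_map_lapPolynomial]
  simp only [degree_derivedGraph]
  have := α.det_smul_adjMatrix_derivedGraph_add_diagonal hρ (-1) (fun v => (G.degree v : ℂ) + -x)
  convert this.trans _
  refine Finset.prod_eq_zero (Finset.mem_univ i) ?_
  rw [pow_eq_zero_iff hfi]
  have hx' := (Polynomial.mem_roots'.1 hx).2
  rw [Polynomial.IsRoot, Matrix.eval_charpoly] at hx'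
  refine Eq.trans (congrArg Matrix.det ?_) ((Matrix.det_neg _).trans
    ((congrArg _ hx').trans (mul_zero _)))
  ext ⟨a, u⟩ ⟨b, v⟩
  by_cases h1 : a = b <;> by_cases h2 : u = v <;> simp [h1, h2, sub_eq_add_neg, add_assoc]

end VoltageAssignment

/-! ### Comparison of the covering with its base -/

namespace VoltageAssignment

variable {V : Type*} {G : SimpleGraph V} {Γ : Type*} [Group Γ] [Fintype V] [Fintype Γ]
  {ι : Type*} [Fintype ι] [DecidableEq ι] {f : ι → ℕ}
  {ρ : (i : ι) → Γ →* Matrix (Fin (f i)) (Fin (f i)) ℂ}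

open Classical in
lemma det_derivedGraph_eq_mul_prod_erase (hρ : IsCompleteIrreducibleList f ρ)
    (α : VoltageAssignment G Γ) (i₁ : ι) (hf₁ : f i₁ = 1) (hρ₁ : ρ i₁ = 1) (b : ℂ) (c : V → ℂ) :
    (b • α.derivedGraph.adjMatrix ℂ + Matrix.diagonal fun p : V × Γ => c p.1).det
      = (b • G.adjMatrix ℂ + Matrix.diagonal c).det * ∏ i ∈ Finset.univ.erase i₁,
        (b • ∑ g, ρ i g ⊗ₖ α.adjPart g
          + (1 : Matrix (Fin (f i)) (Fin (f i)) ℂ) ⊗ₖ Matrix.diagonal c).det ^ f i := by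
  have hpow : ∀ x : ℂ, x ^ f i₁ = x := by intro x; rw [hf₁, pow_one]
  rw [α.det_smul_adjMatrix_derivedGraph_add_diagonal hρ, ← Finset.mul_prod_erase _ _
    (Finset.mem_univ i₁), hpow, α.det_trivial_factor hf₁ _ hρ₁]

lemma eval_iharaPolynomial_derivedGraph (hρ : IsCompleteIrreducibleList f ρ)
    (α : VoltageAssignment G Γ) (i₁ : ι) (hf₁ : f i₁ = 1) (hρ₁ : ρ i₁ = 1) (s : ℂ) :
    (α.derivedGraph.iharaPolynomial.map (algebraMap ℝ ℂ)).eval s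
      = (G.iharaPolynomial.map (algebraMap ℝ ℂ)).eval s *
        ∏ i ∈ Finset.univ.erase i₁, α.twistedDet (ρ i) (1 + s) ^ f i := by
  classical
  simp only [SimpleGraph.eval_map_iharaPolynomial, twistedDet_eq, degree_derivedGraph]
  convert α.det_derivedGraph_eq_mul_prod_erase hρ i₁ hf₁ hρ₁ (-(1 + s))
    (fun v => 1 + (1 + s) ^ 2 * ((G.degree v : ℂ) - 1))

open Classical in
lemma eval_lapPolynomial_derivedGraph (hρ : IsCompleteIrreducibleList f ρ)
    (α : VoltageAssignment G Γ) (i₁ : ι) (hf₁ : f i₁ = 1) (hρ₁ : ρ i₁ = 1) (s : ℂ) :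
    (α.derivedGraph.lapPolynomial.map (algebraMap ℝ ℂ)).eval s
      = (G.lapPolynomial.map (algebraMap ℝ ℂ)).eval s * ∏ i ∈ Finset.univ.erase i₁,
        ((-1 : ℂ) • ∑ g, ρ i g ⊗ₖ α.adjPart g + (1 : Matrix (Fin (f i)) (Fin (f i)) ℂ) ⊗ₖ
          Matrix.diagonal fun v => (G.degree v : ℂ) + s).det ^ f i := by
  simp only [SimpleGraph.eval_map_lapPolynomial, degree_derivedGraph]
  convert α.det_derivedGraph_eq_mul_prod_erase hρ i₁ hf₁ hρ₁ (-1)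
    (fun v => (G.degree v : ℂ) + s)

open Polynomial

lemma exists_polynomial_eval_eq_twistedDet (α : VoltageAssignment G Γ) {d : ℕ}
    (σ : Γ →* Matrix (Fin d) (Fin d) ℂ) : ∃ p : ℂ[X], ∀ t, p.eval t = α.twistedDet σ t := by
  classical
  obtain ⟨p, hp⟩ := Matrix.exists_polynomial_eval_eq_det 1 (-∑ g, σ g ⊗ₖ α.adjPart g)
    ((1 : Matrix (Fin d) (Fin d) ℂ) ⊗ₖ (G.degMatrix ℂ - 1))
  refine ⟨p, fun t => ?_⟩
  rw [hp, twistedDet, smul_neg, ← sub_eq_add_neg]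

/-- Comparison of the numbers of spanning trees of a covering graph and of its base. -/
lemma card_mul_complexity_derivedGraph [Nonempty V] (hρ : IsCompleteIrreducibleList f ρ)
    (α : VoltageAssignment G Γ) (i₁ : ι) (hf₁ : f i₁ = 1) (hρ₁ : ρ i₁ = 1) :
    (Fintype.card Γ : ℂ) * α.derivedGraph.complexity
      = G.complexity * ∏ i ∈ Finset.univ.erase i₁, α.twistedDet (ρ i) 1 ^ f i := by
  classical
  have hex : ∀ i, ∃ p : ℂ[X], ∀ s, p.eval s =
      ((-1 : ℂ) • ∑ g, ρ i g ⊗ₖ α.adjPart g + (1 : Matrix (Fin (f i)) (Fin (f i)) ℂ) ⊗ₖ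
          Matrix.diagonal fun v => (G.degree v : ℂ) + s).det := by
    intro i
    obtain ⟨p, hp⟩ := Matrix.exists_polynomial_eval_eq_det
      ((-1 : ℂ) • ∑ g, ρ i g ⊗ₖ α.adjPart g + (1 : Matrix (Fin (f i)) (Fin (f i)) ℂ) ⊗ₖ
          Matrix.diagonal fun v => (G.degree v : ℂ)) 1 0
    refine ⟨p, fun s => ?_⟩
    rw [hp]
    congr 1
    ext ⟨a, u⟩ ⟨b, v⟩
    by_cases h1 : a = b <;> by_cases h2 : u = v <;> simp [h1, h2, add_assoc]
  choose l hl using hex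
  have hpoly : α.derivedGraph.lapPolynomial.map (algebraMap ℝ ℂ)
      = G.lapPolynomial.map (algebraMap ℝ ℂ) * ∏ i ∈ Finset.univ.erase i₁, l i ^ f i := by
    refine Polynomial.funext fun s => ?_
    rw [α.eval_lapPolynomial_derivedGraph hρ i₁ hf₁ hρ₁, eval_mul, eval_prod]
    simp only [eval_pow, hl]
  -- Both Laplacian polynomials vanish at 0, so only the constant term of the product enters. The
  -- common factor |V| cancels below.
  have h1 := congrArg (fun p => p.coeff 1) hpoly
  simp only [mul_coeff_one, coeff_map, SimpleGraph.coeff_one_lapPolynomial,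
    SimpleGraph.coeff_zero_lapPolynomial] at h1
  rw [coeff_zero_eq_eval_zero, eval_prod] at h1
  have h2 : ∀ i, (l i).eval 0 = α.twistedDet (ρ i) 1 := by
    intro i
    rw [hl, twistedDet_eq]
    simp
  simp only [eval_pow, h2] at h1
  have hn : (Fintype.card V : ℂ) ≠ 0 := by exact_mod_cast Fintype.card_ne_zero
  apply mul_left_cancel₀ hn
  simp only [Fintype.card_prod] at h1
  push_cast at h1
  rw [zero_mul, zero_add] at h1
  linear_combination h1

end VoltageAssignment

theorem corollary3 {V Γ ι : Type*} [Fintype V] [Group Γ] [Fintype Γ] [Fintype ι] [DecidableEq ι]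
    (G : SimpleGraph V) (hG : G.Connected)
    (n m : ℕ) (hn : Fintype.card V = n) (hm : G.edgeSet.ncard = m)
    (α : VoltageAssignment G Γ) (hα : α.derivedGraph.Connected)
    (f : ι → ℕ) (ρ : (i : ι) → Γ →* Matrix (Fin (f i)) (Fin (f i)) ℂ)
    (hρ : IsCompleteIrreducibleList f ρ)
    (i₁ : ι) (hf₁ : f i₁ = 1) (hρ₁ : ρ i₁ = 1) :
    (∀ i, i ≠ i₁ → α.twistedDet (ρ i) 1 ≠ 0 ∧
      DifferentiableAt ℂ (fun t : ℂ => Complex.log (α.twistedDet (ρ i) t)) 1) ∧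
    (α.derivedGraph.kirchhoffZ : ℂ) =
      (Fintype.card Γ : ℂ) * (G.kirchhoffZ : ℂ)
        - 2 * ((m : ℂ) - n) * n * ((Fintype.card Γ : ℂ) ^ 2 - Fintype.card Γ)
        + 2 * (Fintype.card Γ : ℂ) * ((m : ℂ) - n) *
          ∑ i ∈ Finset.univ.erase i₁,
            (f i : ℂ) * deriv (fun t : ℂ => Complex.log (α.twistedDet (ρ i) t)) 1 := by
  classical
  have : Nonempty V := hG.nonempty
  have : Nonempty (V × Γ) := hα.nonempty
  have hΓ : (Fintype.card Γ : ℂ) ≠ 0 := by exact_mod_cast Fintype.card_ne_zero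
  have hκ' : (α.derivedGraph.complexity : ℂ) ≠ 0 := by exact_mod_cast hα.complexity_pos.ne'
  choose K hK using fun i => α.exists_polynomial_eval_eq_twistedDet (ρ i)
  have hκ := α.card_mul_complexity_derivedGraph hρ i₁ hf₁ hρ₁
  set P : ℂ := ∏ i ∈ Finset.univ.erase i₁, α.twistedDet (ρ i) 1 ^ f i with hP
  -- This is where connectedness of the covering enters: it has a spanning tree.
  have hP0 : P ≠ 0 := right_ne_zero_of_mul (hκ ▸ mul_ne_zero hΓ hκ')
  have hslit : ∀ i, i ≠ i₁ → α.twistedDet (ρ i) 1 ∈ Complex.slitPlane := by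
    intro i hi
    have hne : α.twistedDet (ρ i) 1 ≠ 0 := by
      intro h0
      have := Finset.prod_ne_zero_iff.1 hP0 i (Finset.mem_erase.2 ⟨hi, Finset.mem_univ i⟩)
      by_cases hf : f i = 0
      · have : IsEmpty (Fin (f i) × V) := by rw [hf]; infer_instance
        rw [VoltageAssignment.twistedDet, Matrix.det_isEmpty] at h0
        exact one_ne_zero h0
      · exact this (by rw [h0, zero_pow hf])
    obtain ⟨r, hr, hKr⟩ := α.exists_nonneg_twistedDet_one hρ i
    rw [hKr, Complex.ofReal_mem_slitPlane]
    refine lt_of_le_of_ne hr fun h0 => hne ?_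
    rw [hKr, ← h0, Complex.ofReal_zero]
  have hdiff : ∀ i, DifferentiableAt ℂ (fun t => α.twistedDet (ρ i) t) 1 := by
    intro i
    simp only [← hK]
    exact (K i).differentiableAt
  refine ⟨fun i hi => ⟨Complex.slitPlane_ne_zero (hslit i hi), (hdiff i).clog (hslit i hi)⟩, ?_⟩
  set Q := ∏ i ∈ Finset.univ.erase i₁, K i ^ f i with hQ
  have hQeval : ∀ t, Q.eval t = ∏ i ∈ Finset.univ.erase i₁, α.twistedDet (ρ i) t ^ f i := by
    intro t
    simp only [hQ, Polynomial.eval_prod, Polynomial.eval_pow, hK]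
  set k := Q.comp (1 + Polynomial.X) with hk
  have hk0 : k.coeff 0 = P := by
    rw [Polynomial.coeff_zero_eq_eval_zero, hk, Polynomial.eval_comp, hQeval]
    simp [hP]
  have hk1 : k.coeff 1 = P * ∑ i ∈ Finset.univ.erase i₁,
      (f i : ℂ) * deriv (fun t : ℂ => Complex.log (α.twistedDet (ρ i) t)) 1 := by
    have h1 : k.coeff 1 = deriv (fun t => Q.eval t) 1 := by
      have := Polynomial.coeff_derivative k 0
      rw [Polynomial.coeff_zero_eq_eval_zero, hk, Polynomial.derivative_comp] at this
      simp at this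
      rw [Polynomial.deriv, hk, ← this]
    have h2 : logDeriv (fun t => Q.eval t) 1 = ∑ i ∈ Finset.univ.erase i₁,
        (f i : ℂ) * deriv (fun t : ℂ => Complex.log (α.twistedDet (ρ i) t)) 1 := by
      simp only [hQeval]
      rw [logDeriv_prod]
      · refine Finset.sum_congr rfl fun i hi => ?_
        rw [logDeriv_fun_pow (hdiff i)]
        congr 1
        exact ((hdiff i).hasDerivAt.clog (hslit i (Finset.ne_of_mem_erase hi))).deriv.symm
      · intro i hi
        exact pow_ne_zero _ (Complex.slitPlane_ne_zero (hslit i (Finset.ne_of_mem_erase hi)))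
      · intro i _
        exact (hdiff i).pow _
    rw [h1, ← h2, logDeriv_apply, hQeval, mul_div_cancel₀ _ hP0]
  have hpoly : α.derivedGraph.iharaPolynomial.map (algebraMap ℝ ℂ)
      = G.iharaPolynomial.map (algebraMap ℝ ℂ) * k := by
    refine Polynomial.funext fun s => ?_
    rw [α.eval_iharaPolynomial_derivedGraph hρ i₁ hf₁ hρ₁, Polynomial.eval_mul, hk,
      Polynomial.eval_comp, hQeval]
    simp
  have hdeg : ∑ v, ((G.degree v : ℝ) - 2) = 2 * ((m : ℝ) - n) := by
    have h1 := G.sum_degrees_eq_twice_card_edges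
    rw [← SimpleGraph.coe_edgeFinset, Set.ncard_coe_finset] at hm
    rw [hm] at h1
    rw [Finset.sum_sub_distrib, ← Nat.cast_sum, h1]
    simp [hn]
    ring
  have hdeg' : ∑ p, ((α.derivedGraph.degree p : ℝ) - 2) = Fintype.card Γ * (2 * ((m : ℝ) - n)) := by
    simp only [VoltageAssignment.degree_derivedGraph]
    rw [Fintype.sum_prod_type, ← hdeg, Finset.mul_sum]
    refine Finset.sum_congr rfl fun v _ => ?_
    change ∑ _ : Γ, ((G.degree v : ℝ) - 2) = _
    rw [Finset.sum_const, Finset.card_univ, nsmul_eq_mul]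
  -- The base polynomial has zero constant term, so the second-order coefficient of `k` plays no
  -- role.
  have h2 := congrArg (fun p => p.coeff 2) hpoly
  simp only [Polynomial.coeff_mul, Finset.Nat.antidiagonal_succ, Finset.Nat.antidiagonal_zero,
    Finset.map_singleton, Finset.sum_cons, Finset.map_cons, Finset.sum_singleton,
    Polynomial.coeff_map, SimpleGraph.coeff_zero_iharaPolynomial, map_zero, zero_mul,
    zero_add] at h2
  change algebraMap ℝ ℂ (α.derivedGraph.iharaPolynomial.coeff 2)
    = algebraMap ℝ ℂ (G.iharaPolynomial.coeff 1) * k.coeff 1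
      + algebraMap ℝ ℂ (G.iharaPolynomial.coeff 2) * k.coeff 0 at h2
  rw [SimpleGraph.coeff_one_iharaPolynomial, SimpleGraph.coeff_two_iharaPolynomial _ hG,
    SimpleGraph.coeff_two_iharaPolynomial _ hα, hdeg, hdeg', hk0, hk1, Fintype.card_prod, hn,
    Complex.coe_algebraMap] at h2
  push_cast at h2
  apply mul_left_cancel₀ hκ'
  -- Both terms on the right of `h2` contain κ(G)·P, which `hκ` replaces by |Γ| κ(G^α); the
  -- multiplier collects their cofactors.
  linear_combination h2 - (2 * ((m : ℂ) - n) * (∑ i ∈ Finset.univ.erase i₁,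
    (f i : ℂ) * deriv (fun t : ℂ => Complex.log (α.twistedDet (ρ i) t)) 1)
    + (n * (2 * ((m : ℂ) - n)) + n + G.kirchhoffZ)) * hκ
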